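/- For a real number $q>1$ and a positive integer $m$, let $$X^m(q)=\Bigl\{\sum_{i=0}^n s_iq^i \;:\; n\ge 0,\ s_i\in\{0,1,\dots,m\}\Bigr\}.$$ Every bounded interval contains only finitely many points of this unbounded set, so its elements can be listed in increasing order as $0=x_0^m(q)<x_1^m(q)<x_2^m(q)<\cdots$. Put $$\ell^m(q)=\liminf_{n\to\infty}\bigl(x_{n+1}^m(q)-x_n^m(q)\bigr),\qquad L^m(q)=\limsup_{n\to\infty}\bigl(x_{n+1}^m(q)-x_n^m(q)\bigr).$$ A Pisot number is a real algebraic integer $>1$ all of whose other (complex) conjugates have modulus strictly less than one. **Theorem.** If a real number $q>1$ is not a Pisot number, then $\ell^{2m}(q)=0$ and $L^{3m}(q)=0$ for every integer $m>q-1$. -/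

import Mathlib

open Filter

/-- A Pisot number: a real algebraic integer `q > 1` all of whose other (complex) algebraic
conjugates have modulus strictly less than one. -/
def IsPisot (q : ℝ) : Prop :=
  1 < q ∧ IsIntegral ℤ q ∧ ∀ z : ℂ, IsConjRoot ℚ (q : ℂ) z → z ≠ (q : ℂ) → ‖z‖ < 1

/-- The set `X^m(q)` of all finite sums `∑_{i=0}^n s_i q^i`, `n = 0, 1, …`, with digits
`s_i ∈ {0, 1, …, m}`. -/
def digitSumSet (m : ℕ) (q : ℝ) : Set ℝ :=
  {x | ∃ (n : ℕ) (s : ℕ → ℕ), (∀ i, s i ≤ m) ∧ x = ∑ i ∈ Finset.range (n + 1), (s i : ℝ) * q ^ i}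

/-- The increasing enumeration `x_0 < x_1 < x_2 < ⋯` of `X^m(q)`: `x_0` is the least element of
`X^m(q)`, and `x_{k+1}` is the least element of `X^m(q)` exceeding `x_k`. That this is an
enumeration when `q > 1` and `m ≥ 1` is proved in `strictMono_digitSumSeq` and
`range_digitSumSeq`. -/
noncomputable def digitSumSeq (m : ℕ) (q : ℝ) : ℕ → ℝ
  | 0 => sInf (digitSumSet m q)
  | k + 1 => sInf (digitSumSet m q ∩ Set.Ioi (digitSumSeq m q k))

/-- `ℓ^m(q) = liminf_n (x_{n+1} - x_n)`. It is taken in the extended reals, where it always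
exists. -/
noncomputable def liminfGap (m : ℕ) (q : ℝ) : EReal :=
  liminf (fun n : ℕ => ((digitSumSeq m q (n + 1) - digitSumSeq m q n : ℝ) : EReal)) atTop

/-- `L^m(q) = limsup_n (x_{n+1} - x_n)`. It is taken in the extended reals, where it always
exists (the gaps may be unbounded when `q > m + 1`). -/
noncomputable def limsupGap (m : ℕ) (q : ℝ) : EReal :=
  limsup (fun n : ℕ => ((digitSumSeq m q (n + 1) - digitSumSeq m q n : ℝ) : EReal)) atTop

/-- Every bounded interval contains only finitely many elements of `X^m(q)`. -/
theorem finite_digitSumSet_inter_Iic (m : ℕ) {q : ℝ} (hq : 1 < q) (B : ℝ) :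
    (digitSumSet m q ∩ Set.Iic B).Finite := by
  obtain ⟨N, hN⟩ := pow_unbounded_of_one_lt B hq
  have h0 : 0 < q := by linarith
  refine (Set.finite_range (fun t : Fin N → Fin (m + 1) =>
    ∑ i : Fin N, ((t i : ℕ) : ℝ) * q ^ (i : ℕ))).subset ?_
  rintro x ⟨⟨n, s, hs, rfl⟩, hx⟩
  have hz : ∀ i ∈ Finset.range (n + 1), N ≤ i → s i = 0 := by
    intro i hi hNi
    by_contra hne
    have h1 : (1 : ℝ) ≤ s i := by exact_mod_cast Nat.one_le_iff_ne_zero.mpr hne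
    have h2 : (s i : ℝ) * q ^ i ≤ ∑ i ∈ Finset.range (n + 1), (s i : ℝ) * q ^ i :=
      Finset.single_le_sum (f := fun i => (s i : ℝ) * q ^ i) (fun j _ => by positivity) hi
    have h3 : q ^ N ≤ q ^ i := pow_le_pow_right₀ hq.le hNi
    have h4 : q ^ i ≤ (s i : ℝ) * q ^ i := le_mul_of_one_le_left (by positivity) h1
    have h5 : ∑ i ∈ Finset.range (n + 1), (s i : ℝ) * q ^ i ≤ B := hx
    linarith
  refine ⟨fun i => ⟨if (i : ℕ) < n + 1 then s i else 0, ?_⟩, ?_⟩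
  · split_ifs
    · exact Nat.lt_succ_of_le (hs _)
    · omega
  · simp only
    rw [Fin.sum_univ_eq_sum_range
      (fun i => (((if i < n + 1 then s i else 0 : ℕ)) : ℝ) * q ^ i) N]
    have e1 : ∑ i ∈ Finset.range (n + 1), (s i : ℝ) * q ^ i
        = ∑ i ∈ Finset.range (n + 1) with i < N, (s i : ℝ) * q ^ i := by
      rw [Finset.sum_filter]
      refine Finset.sum_congr rfl fun i hi => ?_
      split_ifs with h
      · rfl
      · rw [hz i hi (not_lt.mp h)]; simp
    have e2 : ∑ i ∈ Finset.range N, (((if i < n + 1 then s i else 0 : ℕ)) : ℝ) * q ^ i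
        = ∑ i ∈ Finset.range N with i < n + 1, (s i : ℝ) * q ^ i := by
      rw [Finset.sum_filter]
      refine Finset.sum_congr rfl fun i _ => ?_
      split_ifs <;> simp
    rw [e1, e2]
    refine Finset.sum_congr ?_ fun _ _ => rfl
    ext i
    simp only [Finset.mem_filter, Finset.mem_range]
    exact and_comm

/-- A nonempty subset of `X^m(q)` has a least element, namely its infimum. -/
theorem isLeast_sInf_of_subset_digitSumSet (m : ℕ) {q : ℝ} (hq : 1 < q) {S : Set ℝ}
    (hS : S ⊆ digitSumSet m q) (hne : S.Nonempty) : IsLeast S (sInf S) := by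
  obtain ⟨y, hy⟩ := hne
  have hfin : (S ∩ Set.Iic y).Finite :=
    (finite_digitSumSet_inter_Iic m hq y).subset (Set.inter_subset_inter_left _ hS)
  obtain ⟨a, ha, hmin⟩ := Set.exists_min_image _ id hfin ⟨y, hy, le_refl y⟩
  have hl : IsLeast S a := by
    refine ⟨ha.1, fun z hz => ?_⟩
    rcases le_total z y with h | h
    · exact hmin z ⟨hz, h⟩
    · exact le_trans ha.2 h
  rw [hl.csInf_eq]
  exact hl

/-- `X^m(q)` is unbounded. -/
theorem nonempty_digitSumSet_inter_Ioi {m : ℕ} (hm : 1 ≤ m) {q : ℝ} (hq : 1 < q) (B : ℝ) :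
    (digitSumSet m q ∩ Set.Ioi B).Nonempty := by
  obtain ⟨N, hN⟩ := pow_unbounded_of_one_lt B hq
  refine ⟨q ^ N, ⟨N, fun i => if i = N then 1 else 0, fun i => ?_, ?_⟩, hN⟩
  · dsimp only
    split_ifs <;> omega
  · simp

theorem isLeast_digitSumSeq_zero (m : ℕ) {q : ℝ} (hq : 1 < q) :
    IsLeast (digitSumSet m q) (digitSumSeq m q 0) :=
  isLeast_sInf_of_subset_digitSumSet m hq subset_rfl
    ⟨0, 0, fun _ => 0, fun _ => Nat.zero_le _, by simp⟩

theorem isLeast_digitSumSeq_succ {m : ℕ} (hm : 1 ≤ m) {q : ℝ} (hq : 1 < q) (k : ℕ) :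
    IsLeast (digitSumSet m q ∩ Set.Ioi (digitSumSeq m q k)) (digitSumSeq m q (k + 1)) :=
  isLeast_sInf_of_subset_digitSumSet m hq Set.inter_subset_left
    (nonempty_digitSumSet_inter_Ioi hm hq _)

theorem strictMono_digitSumSeq {m : ℕ} (hm : 1 ≤ m) {q : ℝ} (hq : 1 < q) :
    StrictMono (digitSumSeq m q) :=
  strictMono_nat_of_lt_succ fun k => (isLeast_digitSumSeq_succ hm hq k).1.2

theorem range_digitSumSeq {m : ℕ} (hm : 1 ≤ m) {q : ℝ} (hq : 1 < q) :
    Set.range (digitSumSeq m q) = digitSumSet m q := by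
  have hmem : ∀ k, digitSumSeq m q k ∈ digitSumSet m q := by
    rintro (_ | k)
    · exact (isLeast_digitSumSeq_zero m hq).1
    · exact (isLeast_digitSumSeq_succ hm hq k).1.1
  refine Set.Subset.antisymm (Set.range_subset_iff.mpr hmem) fun x hx => ?_
  by_contra hnot
  have hlt : ∀ k, digitSumSeq m q k < x := by
    intro k
    induction k with
    | zero =>
      exact lt_of_le_of_ne ((isLeast_digitSumSeq_zero m hq).2 hx) fun h => hnot ⟨0, h⟩
    | succ k ih =>
      exact lt_of_le_of_ne ((isLeast_digitSumSeq_succ hm hq k).2 ⟨hx, ih⟩)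
        fun h => hnot ⟨k + 1, h⟩
  exact Set.infinite_range_of_injective (strictMono_digitSumSeq hm hq).injective
    ((finite_digitSumSet_inter_Iic m hq x).subset
      (Set.range_subset_iff.mpr fun k => ⟨hmem k, (hlt k).le⟩))

/-!
The differences of points of `X^m(q)` are the values at `q` of the integer polynomials of height at
most `m` (coefficients in `{-m, …, m}`); these values form the spectrum `Y^m(q)`.

If `Y^{2m}(q)` has arbitrarily small positive elements, both claims follow
(`gaps_eq_zero_of_small_differences`): a short step far out is obtained by adding a high power of
`q`, and many short steps at disjoint digit positions form an `ε`-dense chain of length `1` in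
`X^{2m}(q)`, which together with the gaps at most `1` of `X^m(q)` makes `X^{3m}(q)` eventually
`ε`-dense.

Otherwise the nonzero elements of `Y^{2m}(q)` are bounded away from `0` (`SeparatedValues`), and `q`
has to be a Pisot number. Bounded parts of `Y^m(q)` are then finite, so `q` is an algebraic integer,
and if `z` is another conjugate with `|z| ≥ 1`, polynomials of height `m` with bounded values at `q`
have bounded values at `z`. The number `m` may be replaced by `⌊q⌋`.

The central point is `SeparatedValues.digits_mul_eq_zero`. Consider a functional
`P ↦ Re (w P(z)) + c P(q)` vanishing at `P`, and the number `t` whose digit in base `q` is maximal at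
the positions where the functional is positive and `0` where it is negative. Whatever the expansion
of `t ± P(q)` in base `q`, each digit changes in the direction which does not increase the
functional, while the total change is `0`; so the digits change only where the functional vanishes.
Choosing `w` generic shows that the elements of `Y^m(q)` in `(0, 1/2]` are all of the form `k / q`
with an integer `k` (`SeparatedValues.eq_natCast_of_le_half`). Following the element `1` under the
maps `y ↦ q y - s` then leads either to an element `m + 1 - q = k / q`, which makes `q` a quadratic
Pisot number, or to a finite expansion of `1` with digits `m, …, m, s`, which makes `q` a Pisot
number by Brauer's argument (`eq_or_eq_one_of_root`); both contradict the existence of `z`.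
-/

/-! ### Finite digit sums -/

/-- The sums `∑_{i<D} s_i q^i` with digits `s_i ∈ {0, …, m}`: the part of `X^m(q)` using only the
positions below `D`. Keeping track of `D` allows digit sums to be placed in disjoint positions. -/
def digitSumsBelow (m : ℕ) (q : ℝ) (D : ℕ) : Set ℝ :=
  {x | ∃ s : ℕ → ℕ, (∀ i, s i ≤ m) ∧ x = ∑ i ∈ Finset.range D, (s i : ℝ) * q ^ i}

theorem digitSumsBelow_mono_length (m : ℕ) (q : ℝ) {D E : ℕ} (h : D ≤ E) :
    digitSumsBelow m q D ⊆ digitSumsBelow m q E := by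
  rintro x ⟨s, hs, rfl⟩
  refine ⟨fun i => if i < D then s i else 0, fun i => ?_, ?_⟩
  · dsimp only
    split_ifs
    exacts [hs i, Nat.zero_le _]
  · rw [← Finset.sum_subset (Finset.range_mono h)]
    · exact Finset.sum_congr rfl fun i hi => by simp [Finset.mem_range.mp hi]
    · intro i _ hi
      simp [Finset.mem_range.not.mp hi]

theorem digitSumsBelow_subset_digitSumSet (m : ℕ) (q : ℝ) (D : ℕ) :
    digitSumsBelow m q D ⊆ digitSumSet m q := by
  intro x hx
  obtain ⟨s, hs, h⟩ := digitSumsBelow_mono_length m q (Nat.le_succ D) hx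
  exact ⟨D, s, hs, h⟩

theorem exists_mem_digitSumsBelow {m : ℕ} {q x : ℝ} (hx : x ∈ digitSumSet m q) :
    ∃ D, x ∈ digitSumsBelow m q D := by
  obtain ⟨n, s, hs, h⟩ := hx
  exact ⟨n + 1, s, hs, h⟩

theorem zero_mem_digitSumsBelow (m : ℕ) (q : ℝ) (D : ℕ) : 0 ∈ digitSumsBelow m q D :=
  ⟨fun _ => 0, fun _ => Nat.zero_le _, by simp⟩

theorem add_mem_digitSumSet {m k : ℕ} {q x y : ℝ} (hx : x ∈ digitSumSet m q)
    (hy : y ∈ digitSumSet k q) : x + y ∈ digitSumSet (m + k) q := by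
  obtain ⟨D, hx⟩ := exists_mem_digitSumsBelow hx
  obtain ⟨E, hy⟩ := exists_mem_digitSumsBelow hy
  obtain ⟨s, hs, rfl⟩ := digitSumsBelow_mono_length m q (le_max_left D E) hx
  obtain ⟨t, ht, rfl⟩ := digitSumsBelow_mono_length k q (le_max_right D E) hy
  refine digitSumsBelow_subset_digitSumSet _ _ (max D E)
    ⟨fun i => s i + t i, fun i => add_le_add (hs i) (ht i), ?_⟩
  rw [← Finset.sum_add_distrib]
  exact Finset.sum_congr rfl fun i _ => by push_cast; ring

/-- Digit sums occupying disjoint ranges of positions can be added without enlarging the digits. -/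
theorem add_pow_mul_mem_digitSumsBelow {m : ℕ} {q x y : ℝ} {D E N : ℕ}
    (hx : x ∈ digitSumsBelow m q D) (hy : y ∈ digitSumsBelow m q E) (hN : D ≤ N) :
    x + q ^ N * y ∈ digitSumsBelow m q (N + E) := by
  obtain ⟨s, hs, rfl⟩ := digitSumsBelow_mono_length m q hN hx
  obtain ⟨t, ht, rfl⟩ := hy
  refine ⟨fun i => if i < N then s i else t (i - N), fun i => ?_, ?_⟩
  · dsimp only
    split_ifs
    exacts [hs i, ht _]
  · rw [Finset.sum_range_add, Finset.mul_sum]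
    congr 1
    · exact Finset.sum_congr rfl fun i hi => by simp [Finset.mem_range.mp hi]
    · refine Finset.sum_congr rfl fun i _ => ?_
      simp only [Nat.not_lt.mpr (Nat.le_add_right N i), if_false, Nat.add_sub_cancel_left]
      ring

theorem mul_add_mem_digitSumsBelow {m : ℕ} {q y : ℝ} {D s : ℕ} (hy : y ∈ digitSumsBelow m q D)
    (hs : s ≤ m) : q * y + s ∈ digitSumsBelow m q (1 + D) := by
  have h := add_pow_mul_mem_digitSumsBelow (D := 1) (N := 1) (x := s)
    ⟨fun _ => s, fun _ => hs, by simp⟩ hy le_rfl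
  rwa [pow_one, add_comm (s : ℝ)] at h

/-- The gaps of `X^m(q)` are at most `1` when `q ≤ m + 1`. -/
theorem exists_mem_digitSumSet_le_lt_add_one {m : ℕ} {q : ℝ} (hq : 1 < q) (hm : q ≤ m + 1)
    {T : ℝ} (hT : 0 ≤ T) : ∃ x ∈ digitSumSet m q, x ≤ T ∧ T < x + 1 := by
  have key : ∀ (N : ℕ) (T : ℝ), 0 ≤ T → T < q ^ N →
      ∃ x ∈ digitSumsBelow m q N, x ≤ T ∧ T < x + 1 := by
    intro N
    induction N with
    | zero =>
      intro T h0 h1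
      exact ⟨0, zero_mem_digitSumsBelow _ _ _, h0, by simpa using h1⟩
    | succ N ih =>
      intro T h0 h1
      have hq0 : 0 < q := by linarith
      obtain ⟨x, hx, hx1, hx2⟩ := ih (T / q) (by positivity)
        (by rwa [div_lt_iff₀ hq0, ← pow_succ])
      rw [le_div_iff₀ hq0] at hx1
      rw [div_lt_iff₀ hq0] at hx2
      have hr : 0 ≤ T - q * x := by linarith
      have hfl := Nat.floor_le hr
      have hfl2 := Nat.lt_floor_add_one (T - q * x)
      refine ⟨q * x + ⌊T - q * x⌋₊, ?_, by linarith, by linarith⟩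
      rw [add_comm N]
      refine mul_add_mem_digitSumsBelow hx ?_
      have : ((⌊T - q * x⌋₊ : ℕ) : ℝ) < ((m + 1 : ℕ) : ℝ) := by push_cast; nlinarith
      exact Nat.lt_succ_iff.mp (by exact_mod_cast this)
  obtain ⟨N, hN⟩ := pow_unbounded_of_one_lt T hq
  obtain ⟨x, hx, h⟩ := key N T hT hN
  exact ⟨x, digitSumsBelow_subset_digitSumSet _ _ _ hx, h⟩

/-! ### Gaps of the enumeration -/

theorem digitSumSeq_succ_le {m : ℕ} (hm : 1 ≤ m) {q : ℝ} (hq : 1 < q) {n : ℕ} {x : ℝ}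
    (hx : x ∈ digitSumSet m q) (h : digitSumSeq m q n < x) : digitSumSeq m q (n + 1) ≤ x :=
  (isLeast_digitSumSeq_succ hm hq n).2 ⟨hx, h⟩

theorem tendsto_digitSumSeq {m : ℕ} (hm : 1 ≤ m) {q : ℝ} (hq : 1 < q) :
    Tendsto (digitSumSeq m q) atTop atTop := by
  refine tendsto_atTop_atTop_of_monotone (strictMono_digitSumSeq hm hq).monotone fun B => ?_
  obtain ⟨x, hx, hB⟩ := nonempty_digitSumSet_inter_Ioi hm hq B
  rw [← range_digitSumSeq hm hq] at hx
  obtain ⟨n, rfl⟩ := hx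
  exact ⟨n, hB.le⟩

/-- Adding a high power of `q` to two close points of `X^m(q)` moves them arbitrarily far out. -/
theorem liminfGap_eq_zero {m : ℕ} (hm : 1 ≤ m) {q : ℝ} (hq : 1 < q)
    (h : ∀ ε : ℝ, 0 < ε → ∃ x ∈ digitSumSet m q, ∃ y ∈ digitSumSet m q, y < x ∧ x < y + ε) :
    liminfGap m q = 0 := by
  refine le_antisymm ?_ ?_
  · refine EReal.le_of_forall_lt_iff_le.mp fun ε hε => ?_
    have hε : (0 : ℝ) < ε := by exact_mod_cast hε
    refine liminf_le_of_frequently_le' ?_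
    rw [frequently_atTop]
    intro n₀
    obtain ⟨x, hx, y, hy, hyx, hxy⟩ := h ε hε
    obtain ⟨D, hx⟩ := exists_mem_digitSumsBelow hx
    obtain ⟨E, hy⟩ := exists_mem_digitSumsBelow hy
    obtain ⟨N, hN⟩ := pow_unbounded_of_one_lt (digitSumSeq m q n₀) hq
    have hq0 : 0 < q := by linarith
    have h1 : (1 : ℝ) ∈ digitSumsBelow m q 1 := ⟨fun _ => 1, fun _ => hm, by simp⟩
    set K := max N (max D E) with hK
    have hKN : q ^ N ≤ q ^ K := pow_le_pow_right₀ hq.le (le_max_left _ _)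
    have hx' := digitSumsBelow_subset_digitSumSet _ _ _
      (add_pow_mul_mem_digitSumsBelow hx h1 (N := K) (by omega))
    have hy' := digitSumsBelow_subset_digitSumSet _ _ _
      (add_pow_mul_mem_digitSumsBelow hy h1 (N := K) (by omega))
    have hy0 : 0 ≤ y := by
      obtain ⟨s, _, rfl⟩ := hy
      positivity
    have hy'' := hy'
    rw [← range_digitSumSeq hm hq] at hy''
    obtain ⟨n, hn⟩ := hy''
    refine ⟨n, ?_, ?_⟩
    · refine (strictMono_digitSumSeq hm hq).le_iff_le.mp ?_
      linarith
    · have := digitSumSeq_succ_le hm hq (n := n) hx' (by linarith)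
      exact_mod_cast (by linarith : digitSumSeq m q (n + 1) - digitSumSeq m q n ≤ ε)
  · refine le_liminf_of_le (by isBoundedDefault) (Eventually.of_forall fun n => ?_)
    exact_mod_cast sub_nonneg.mpr (strictMono_digitSumSeq hm hq (Nat.lt_succ_self n)).le

theorem limsupGap_eq_zero {m : ℕ} (hm : 1 ≤ m) {q : ℝ} (hq : 1 < q)
    (h : ∀ ε : ℝ, 0 < ε → ∃ a : ℝ, ∀ T : ℝ, a ≤ T → ∃ x ∈ digitSumSet m q, T < x ∧ x ≤ T + ε) :
    limsupGap m q = 0 := by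
  refine le_antisymm ?_ ?_
  · refine EReal.le_of_forall_lt_iff_le.mp fun ε hε => ?_
    have hε : (0 : ℝ) < ε := by exact_mod_cast hε
    obtain ⟨a, ha⟩ := h ε hε
    refine limsup_le_of_le (by isBoundedDefault) ?_
    filter_upwards [(tendsto_digitSumSeq hm hq).eventually_ge_atTop a] with n hn
    obtain ⟨x, hx, h1, h2⟩ := ha _ hn
    have := digitSumSeq_succ_le hm hq hx h1
    exact_mod_cast (by linarith : digitSumSeq m q (n + 1) - digitSumSeq m q n ≤ ε)
  · refine le_trans ?_ liminf_le_limsup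
    refine le_liminf_of_le (by isBoundedDefault) (Eventually.of_forall fun n => ?_)
    exact_mod_cast sub_nonneg.mpr (strictMono_digitSumSeq hm hq (Nat.lt_succ_self n)).le

/-- If the differences of `X^k(q)` accumulate at `0`, then short steps placed in disjoint ranges of
positions add up to an `ε`-dense subset of an interval of any prescribed length. -/
theorem exists_dense_chain {k : ℕ} {q : ℝ} (hq : 1 < q)
    (h : ∀ ε : ℝ, 0 < ε → ∃ x ∈ digitSumSet k q, ∃ y ∈ digitSumSet k q, y < x ∧ x < y + ε)
    {ε : ℝ} (hε : 0 < ε) (L : ℝ) :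
    ∃ a : ℝ, ∀ s : ℝ, 0 ≤ s → s ≤ L → ∃ f ∈ digitSumSet k q, a + s < f ∧ f ≤ a + s + ε := by
  have hq0 : 0 < q := by linarith
  have key : ∀ j : ℕ, ∃ D, ∃ a ∈ digitSumsBelow k q D, ∀ s : ℝ, 0 ≤ s → s < j * (ε / q) →
      ∃ f ∈ digitSumsBelow k q D, a + s < f ∧ f ≤ a + s + ε := by
    intro j
    induction j with
    | zero =>
      refine ⟨0, 0, zero_mem_digitSumsBelow _ _ _, fun s h0 h1 => ?_⟩
      rw [Nat.cast_zero, zero_mul] at h1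
      linarith
    | succ j ih =>
      obtain ⟨D, a, ha, hf⟩ := ih
      obtain ⟨x, hx, y, hy, hyx, hxy⟩ := h (ε / q ^ D) (by positivity)
      obtain ⟨E₁, hx⟩ := exists_mem_digitSumsBelow hx
      obtain ⟨E₂, hy⟩ := exists_mem_digitSumsBelow hy
      replace hx := digitSumsBelow_mono_length k q (le_max_left E₁ E₂) hx
      replace hy := digitSumsBelow_mono_length k q (le_max_right E₁ E₂) hy
      -- the largest power of `q` for which the step `q ^ N * (x - y)` is at most `ε`
      obtain ⟨N, hN1, hN2⟩ : ∃ N : ℕ, q ^ N ≤ ε / (x - y) ∧ ε / (x - y) < q ^ (N + 1) := by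
        refine exists_nat_pow_near ?_ hq
        rw [le_div_iff₀ (by linarith), one_mul]
        have : ε / q ^ D ≤ ε := div_le_self hε.le (one_le_pow₀ hq.le)
        linarith
      have hxy0 : 0 < x - y := by linarith
      rw [le_div_iff₀ hxy0] at hN1
      rw [div_lt_iff₀ hxy0] at hN2
      have hDN : D ≤ N := by
        by_contra hlt
        have h1 : q ^ (N + 1) ≤ q ^ D := pow_le_pow_right₀ hq.le (by omega)
        have h2 : (x - y) * q ^ D < ε := by
          rw [← lt_div_iff₀ (by positivity)]; linarith
        nlinarith
      have hstep : ε / q < q ^ N * (x - y) := by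
        rw [div_lt_iff₀ hq0]
        calc ε < q ^ (N + 1) * (x - y) := hN2
          _ = _ := by ring
      refine ⟨N + max E₁ E₂, a + q ^ N * y, add_pow_mul_mem_digitSumsBelow ha hy hDN,
        fun s h0 h1 => ?_⟩
      push_cast at h1
      rcases lt_or_ge s (q ^ N * (x - y)) with hs | hs
      · refine ⟨a + q ^ N * x, add_pow_mul_mem_digitSumsBelow ha hx hDN, by linarith, by linarith⟩
      · obtain ⟨f, hf, hf1, hf2⟩ := hf (s - q ^ N * (x - y)) (by linarith) (by linarith)
        exact ⟨f + q ^ N * x, add_pow_mul_mem_digitSumsBelow hf hx hDN, by linarith, by linarith⟩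
  obtain ⟨j, hj⟩ := exists_nat_gt (L / (ε / q))
  rw [div_lt_iff₀ (by positivity)] at hj
  obtain ⟨D, a, -, hf⟩ := key j
  refine ⟨a, fun s h0 h1 => ?_⟩
  obtain ⟨f, hf, h⟩ := hf s h0 (by linarith)
  exact ⟨f, digitSumsBelow_subset_digitSumSet _ _ _ hf, h⟩

/-- Adding the points of `X^m(q)`, whose gaps are at most `1`, to an `ε`-dense chain of length `1` in
`X^{2m}(q)` makes `X^{3m}(q)` eventually `ε`-dense. -/
theorem gaps_eq_zero_of_small_differences {m : ℕ} {q : ℝ} (hq : 1 < q) (hm : q - 1 < m)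
    (h : ∀ ε : ℝ, 0 < ε →
      ∃ x ∈ digitSumSet (2 * m) q, ∃ y ∈ digitSumSet (2 * m) q, y < x ∧ x < y + ε) :
    liminfGap (2 * m) q = 0 ∧ limsupGap (3 * m) q = 0 := by
  have hm1 : 1 ≤ m := by
    rw [Nat.one_le_iff_ne_zero]
    rintro rfl
    norm_num at hm
    linarith
  refine ⟨liminfGap_eq_zero (by omega) hq h, limsupGap_eq_zero (by omega) hq fun ε hε => ?_⟩
  obtain ⟨a, ha⟩ := exists_dense_chain hq h hε 1
  refine ⟨a, fun T hT => ?_⟩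
  obtain ⟨x, hx, hx1, hx2⟩ := exists_mem_digitSumSet_le_lt_add_one hq (m := m) (by linarith)
    (sub_nonneg.mpr hT)
  obtain ⟨f, hf, hf1, hf2⟩ := ha (T - a - x) (by linarith) (by linarith)
  refine ⟨x + f, ?_, by linarith, by linarith⟩
  have := add_mem_digitSumSet hx hf
  rwa [show m + 2 * m = 3 * m by ring] at this

/-! ### Expansions in base `q` -/

theorem hasSum_inv_pow_succ {q : ℝ} (hq : 1 < q) :
    HasSum (fun i : ℕ => q⁻¹ ^ (i + 1)) (1 / (q - 1)) := by
  have h := (hasSum_geometric_of_lt_one (r := q⁻¹) (by positivity)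
    (inv_lt_one_of_one_lt₀ hq)).mul_left q⁻¹
  have h0 : q - 1 ≠ 0 := by linarith
  have h1 : q ≠ 0 := by linarith
  have e : q⁻¹ * (1 - q⁻¹)⁻¹ = 1 / (q - 1) := by
    have : 1 - q⁻¹ = (q - 1) / q := by field_simp
    rw [this]
    field_simp
  rw [e] at h
  simpa only [pow_succ'] using h

/-- If `q ≤ m + 1`, every point of `[0, m / (q - 1)]` has an expansion in base `q` with digits
`0, …, m`. -/
theorem exists_expansion {m : ℕ} {q : ℝ} (hq : 1 < q) (hm : q ≤ m + 1) {t : ℝ} (h0 : 0 ≤ t)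
    (h1 : t ≤ m / (q - 1)) :
    ∃ b : ℕ → ℕ, (∀ i, b i ≤ m) ∧ HasSum (fun i => (b i : ℝ) * q⁻¹ ^ (i + 1)) t := by
  have hq0 : 0 < q := by linarith
  have hM1 : 1 ≤ m / (q - 1) := by rw [le_div_iff₀ (by linarith)]; linarith
  set M := m / (q - 1) with hM
  have hqM : q * M = m + M := by
    rw [hM]; field_simp [show q - 1 ≠ 0 by linarith]; ring
  -- the greedy digit and the sequence of remainders
  let digit : ℝ → ℕ := fun r => min ⌊q * r⌋₊ m
  let rem : ℕ → ℝ := fun n => Nat.rec t (fun _ r => q * r - digit r) n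
  have hrem : ∀ n, rem (n + 1) = q * rem n - digit (rem n) := fun n => rfl
  have hrange : ∀ n, 0 ≤ rem n ∧ rem n ≤ M := by
    intro n
    induction n with
    | zero => exact ⟨h0, h1⟩
    | succ n ih =>
      rw [hrem]
      obtain ⟨i0, i1⟩ := ih
      have hp : 0 ≤ q * rem n := by positivity
      have f1 := Nat.floor_le hp
      have f2 := Nat.lt_floor_add_one (q * rem n)
      rcases le_total ⌊q * rem n⌋₊ m with h | h
      · simp only [digit, min_eq_left h]
        constructor <;> linarith
      · simp only [digit, min_eq_right h]
        have : (m : ℝ) ≤ ⌊q * rem n⌋₊ := by exact_mod_cast h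
        constructor
        · linarith
        · nlinarith
  refine ⟨fun n => digit (rem n), fun i => min_le_right _ _, ?_⟩
  rw [hasSum_iff_tendsto_nat_of_nonneg (fun i => by positivity)]
  have hsum : ∀ n, ∑ i ∈ Finset.range n, (digit (rem i) : ℝ) * q⁻¹ ^ (i + 1)
      = t - q⁻¹ ^ n * rem n := by
    intro n
    induction n with
    | zero => simp [rem]
    | succ n ih =>
      rw [Finset.sum_range_succ, ih, hrem, pow_succ]
      field_simp
      ring
  simp_rw [hsum]
  have hz : Tendsto (fun n => q⁻¹ ^ n * rem n) atTop (nhds 0) := by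
    refine squeeze_zero (g := fun n => q⁻¹ ^ n * M) (fun n => ?_) (fun n => ?_) ?_
    · have := (hrange n).1; positivity
    · exact mul_le_mul_of_nonneg_left (hrange n).2 (by positivity)
    · simpa using (tendsto_pow_atTop_nhds_zero_of_lt_one (r := q⁻¹) (by positivity)
        (inv_lt_one_of_one_lt₀ hq)).mul_const M
  simpa using hz.const_sub t

/-! ### Integer polynomials of bounded height -/

section
open Polynomial

/-- `P` has height at most `m`: its coefficients lie in `{-m, …, m}`. The values at `q` of these
polynomials are the differences of elements of `X^m(q)`. -/
def HeightLE (m : ℕ) (P : ℤ[X]) : Prop := ∀ i, |P.coeff i| ≤ m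

theorem HeightLE.neg {m : ℕ} {P : ℤ[X]} (h : HeightLE m P) : HeightLE m (-P) := fun i => by
  simpa using h i

theorem HeightLE.sub {m k : ℕ} {P Q : ℤ[X]} (hP : HeightLE m P) (hQ : HeightLE k Q) :
    HeightLE (m + k) (P - Q) := fun i => by
  rw [coeff_sub]
  push_cast
  exact (abs_sub _ _).trans (add_le_add (hP i) (hQ i))

theorem HeightLE.mono {m k : ℕ} {P : ℤ[X]} (h : HeightLE m P) (hmk : m ≤ k) : HeightLE k P :=
  fun i => (h i).trans (by exact_mod_cast hmk)

theorem HeightLE.X_mul_sub_C {m : ℕ} {P : ℤ[X]} (h : HeightLE m P) {s : ℤ} (hs : |s| ≤ m) :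
    HeightLE m (X * P - C s) := by
  rintro (_ | i)
  · simpa using hs
  · rw [coeff_sub, coeff_X_mul, coeff_C_succ, sub_zero]
    exact h i

theorem heightLE_one {m : ℕ} (hm : 1 ≤ m) : HeightLE m 1 := by
  intro i
  rw [coeff_one]
  split_ifs
  · simpa using hm
  · simp

/-- The positive and the negative coefficients of `P` are the digits of two elements of `X^m(q)` with
difference `P(q)`. -/
theorem HeightLE.exists_sub_eq {m : ℕ} {P : ℤ[X]} (h : HeightLE m P) (q : ℝ) :
    ∃ x ∈ digitSumSet m q, ∃ y ∈ digitSumSet m q, x - y = aeval q P := by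
  refine ⟨_, ⟨P.natDegree, fun i => (P.coeff i).toNat, fun i => ?_, rfl⟩,
    _, ⟨P.natDegree, fun i => (-P.coeff i).toNat, fun i => ?_, rfl⟩, ?_⟩
  · have := abs_le.mp (h i); dsimp only; omega
  · have := abs_le.mp (h i); dsimp only; omega
  · rw [aeval_eq_sum_range, ← Finset.sum_sub_distrib]
    refine Finset.sum_congr rfl fun i _ => ?_
    rw [← sub_mul, zsmul_eq_mul]
    congr 1
    have : (((P.coeff i).toNat : ℤ) - ((-P.coeff i).toNat : ℤ)) = P.coeff i := by omega
    exact_mod_cast this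

/-- A bounded set of reals whose distinct points are at distance at least `δ` is finite. -/
theorem finite_of_separated {S : Set ℝ} {δ C : ℝ} (hδ : 0 < δ) (hC : ∀ x ∈ S, |x| ≤ C)
    (hS : ∀ x ∈ S, ∀ y ∈ S, x ≠ y → δ ≤ |x - y|) : S.Finite := by
  refine Set.Finite.of_finite_image (f := fun x => ⌊x / δ⌋)
    ((Set.finite_Icc ⌊-C / δ⌋ ⌊C / δ⌋).subset ?_) ?_
  · rintro _ ⟨x, hx, rfl⟩
    have := abs_le.mp (hC x hx)
    exact ⟨Int.floor_le_floor (by gcongr; exact this.1), Int.floor_le_floor (by gcongr; exact this.2)⟩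
  · intro x hx y hy hxy
    by_contra hne
    have h1 := Int.abs_sub_lt_one_of_floor_eq_floor hxy
    rw [← sub_div, abs_div, abs_of_pos hδ, div_lt_one hδ] at h1
    exact absurd (hS x hx y hy hne) (not_le.mpr h1)

/-- The nonzero values at `q` of the integer polynomials of height at most `m` are bounded away
from `0`. -/
def SeparatedValues (m : ℕ) (q : ℝ) : Prop :=
  ∃ δ : ℝ, 0 < δ ∧ ∀ P : ℤ[X], HeightLE m P → aeval q P ≠ 0 → δ ≤ |aeval q P|

theorem SeparatedValues.mono {m k : ℕ} {q : ℝ} (h : SeparatedValues k q) (hmk : m ≤ k) :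
    SeparatedValues m q := by
  obtain ⟨δ, hδ, h⟩ := h
  exact ⟨δ, hδ, fun P hP => h P (hP.mono hmk)⟩

theorem SeparatedValues.finite {m : ℕ} {q : ℝ} (h : SeparatedValues (2 * m) q) (R : ℝ) :
    {y : ℝ | ∃ P : ℤ[X], HeightLE m P ∧ aeval q P = y ∧ |y| ≤ R}.Finite := by
  obtain ⟨δ, hδ, h⟩ := h
  refine finite_of_separated (C := R) hδ ?_ ?_
  · rintro x ⟨P, -, -, hx⟩
    exact hx
  · rintro x ⟨P, hP, rfl, -⟩ y ⟨Q, hQ, rfl, -⟩ hxy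
    rw [← map_sub]
    refine h _ ((hP.sub hQ).mono (by omega)) ?_
    rwa [map_sub, sub_ne_zero]

/-- Polynomials of height at most `m` taking bounded values at `q` also take bounded values at a
conjugate `z`, because finitely many values at `q` determine finitely many values at `z`. -/
theorem SeparatedValues.exists_bound {m : ℕ} {q : ℝ} {z : ℂ} (h : SeparatedValues (2 * m) q)
    (hz : ∀ P : ℤ[X], aeval q P = 0 → aeval z P = 0) (R : ℝ) :
    ∃ B : ℝ, ∀ P : ℤ[X], HeightLE m P → |aeval q P| ≤ R → ‖aeval z P‖ ≤ B := by
  have hfin := h.finite R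
  choose! g hg using fun (y : ℝ)
    (hy : y ∈ {y : ℝ | ∃ P : ℤ[X], HeightLE m P ∧ aeval q P = y ∧ |y| ≤ R}) => hy
  obtain ⟨B, hB⟩ := (hfin.image fun y => ‖aeval z (g y)‖).bddAbove
  refine ⟨B, fun P hP hR => ?_⟩
  have hmem : aeval q P ∈ {y : ℝ | ∃ P : ℤ[X], HeightLE m P ∧ aeval q P = y ∧ |y| ≤ R} :=
    ⟨P, hP, rfl, hR⟩
  have he : aeval z P = aeval z (g (aeval q P)) := by
    rw [← sub_eq_zero, ← map_sub]
    refine hz _ ?_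
    rw [map_sub, (hg _ hmem).2.1, sub_self]
  rw [he]
  exact hB ⟨_, hmem, rfl⟩

/-- If the values are separated, then `q` is an algebraic integer: two of the monic polynomials of
different degrees obtained by the greedy algorithm must take the same value at `q`. -/
theorem SeparatedValues.isIntegral {m : ℕ} {q : ℝ} (hq : 1 < q) (hm : q ≤ m + 1)
    (h : SeparatedValues (2 * m) q) : IsIntegral ℤ q := by
  have hm1 : 1 ≤ m := by
    rw [Nat.one_le_iff_ne_zero]
    rintro rfl
    norm_num at hm
    linarith
  have hex : ∀ n : ℕ, ∃ P : ℤ[X], P.Monic ∧ P.natDegree = n ∧ HeightLE m P ∧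
      0 ≤ aeval q P ∧ aeval q P ≤ 1 := by
    intro n
    induction n with
    | zero => exact ⟨1, monic_one, natDegree_one, heightLE_one hm1, by simp, by simp⟩
    | succ n ih =>
      obtain ⟨P, hmon, hdeg, hP, h0, h1⟩ := ih
      have hd : (C ((min ⌊q * aeval q P⌋₊ m : ℕ) : ℤ)).degree < (X * P).degree := by
        refine degree_C_le.trans_lt ?_
        rw [degree_mul, degree_X, degree_eq_natDegree hmon.ne_zero]
        exact_mod_cast (by omega : 0 < 1 + P.natDegree)
      refine ⟨X * P - C ((min ⌊q * aeval q P⌋₊ m : ℕ) : ℤ), ?_, ?_, ?_, ?_⟩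
      · exact (monic_X.mul hmon).sub_of_left hd
      · rw [natDegree_eq_of_degree_eq (degree_sub_eq_left_of_degree_lt hd),
          natDegree_X_mul hmon.ne_zero, hdeg]
      · refine hP.X_mul_sub_C ?_
        rw [Nat.abs_cast]
        exact_mod_cast min_le_right _ _
      · have hp : 0 ≤ q * aeval q P := mul_nonneg (by linarith) h0
        have f1 := Nat.floor_le hp
        have f2 := Nat.lt_floor_add_one (q * aeval q P)
        have e : aeval q (X * P - C ((min ⌊q * aeval q P⌋₊ m : ℕ) : ℤ))
            = q * aeval q P - ((min ⌊q * aeval q P⌋₊ m : ℕ) : ℝ) := by simp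
        rw [e]
        rcases le_total ⌊q * aeval q P⌋₊ m with h | h
        · rw [min_eq_left h]
          constructor <;> linarith
        · rw [min_eq_right h]
          have : (m : ℝ) ≤ ⌊q * aeval q P⌋₊ := by exact_mod_cast h
          constructor
          · linarith
          · nlinarith
  choose P hmon hdeg hP h0 h1 using hex
  have hni : ¬ Function.Injective fun n => aeval q (P n) := by
    intro hinj
    refine Set.infinite_range_of_injective hinj ((h.finite 1).subset ?_)
    rintro _ ⟨n, rfl⟩
    exact ⟨P n, hP n, rfl, abs_le.mpr ⟨by linarith [h0 n], h1 n⟩⟩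
  rw [Function.not_injective_iff] at hni
  obtain ⟨i, j, hij, hne⟩ := hni
  wlog hlt : i < j generalizing i j
  · exact this j i hij.symm hne.symm (by omega)
  refine ⟨P j - P i, (hmon j).sub_of_left ?_, ?_⟩
  · rw [degree_eq_natDegree (hmon i).ne_zero, degree_eq_natDegree (hmon j).ne_zero, hdeg, hdeg]
    exact_mod_cast hlt
  · rw [← aeval_def, map_sub, sub_eq_zero]
    exact hij.symm

/-! ### Sign-coherent expansions -/

/-- The remainders of the expansion `P(x) = ∑ s_i x^{-(i+1)}`: they satisfy
`P_n(x) = x^n P(x) - ∑_{i<n} s_i x^{n-1-i}`. -/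
noncomputable def remainderPoly (P : ℤ[X]) (s : ℕ → ℤ) : ℕ → ℤ[X]
  | 0 => P
  | n + 1 => X * remainderPoly P s n - C (s n)

theorem HeightLE.remainderPoly {m : ℕ} {P : ℤ[X]} {s : ℕ → ℤ} (h : HeightLE m P)
    (hs : ∀ i, |s i| ≤ m) (n : ℕ) : HeightLE m (remainderPoly P s n) := by
  induction n with
  | zero => exact h
  | succ n ih => exact ih.X_mul_sub_C (hs n)

theorem sum_eq_sub_remainderPoly {K : Type*} [Field K] {x : K} (hx : x ≠ 0) (P : ℤ[X])
    (s : ℕ → ℤ) (n : ℕ) :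
    ∑ i ∈ Finset.range n, (s i : K) * x⁻¹ ^ (i + 1)
      = aeval x P - x⁻¹ ^ n * aeval x (remainderPoly P s n) := by
  induction n with
  | zero => simp [remainderPoly]
  | succ n ih =>
    rw [Finset.sum_range_succ, ih]
    simp only [remainderPoly, map_sub, map_mul, aeval_X, eq_intCast, map_intCast,
      pow_succ]
    field_simp
    ring

theorem abs_aeval_remainderPoly_le {m : ℕ} {q : ℝ} (hq : 1 < q) {P : ℤ[X]} {s : ℕ → ℤ}
    (hs : ∀ i, |s i| ≤ m) (hsum : HasSum (fun i => (s i : ℝ) * q⁻¹ ^ (i + 1)) (aeval q P))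
    (n : ℕ) : |aeval q (remainderPoly P s n)| ≤ m / (q - 1) := by
  have hq0 : 0 < q := by linarith
  have h1 := (hasSum_nat_add_iff' n).mpr hsum
  rw [sum_eq_sub_remainderPoly hq0.ne', sub_sub_cancel] at h1
  have h2 := h1.mul_left (q ^ n)
  have hqn : q ^ n * q⁻¹ ^ n = 1 := by rw [← mul_pow, mul_inv_cancel₀ hq0.ne', one_pow]
  have h3 : HasSum (fun i => (s (i + n) : ℝ) * q⁻¹ ^ (i + 1)) (aeval q (remainderPoly P s n)) := by
    rw [← mul_assoc, hqn, one_mul] at h2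
    have hf : (fun i => (s (i + n) : ℝ) * q⁻¹ ^ (i + 1))
        = fun i => q ^ n * ((s (i + n) : ℝ) * q⁻¹ ^ (i + n + 1)) := by
      funext i
      rw [show i + n + 1 = n + (i + 1) by ring, pow_add q⁻¹ n]
      linear_combination (-(s (i + n) : ℝ) * q⁻¹ ^ (i + 1)) * hqn
    rwa [hf]
  have h4 := (hasSum_inv_pow_succ hq).mul_left (m : ℝ)
  rw [mul_one_div] at h4
  have hb : ∀ i, |(s i : ℝ)| ≤ m := fun i => by exact_mod_cast hs i
  have hv : ∀ i : ℕ, 0 ≤ q⁻¹ ^ (i + 1) := fun i => by positivity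
  refine abs_le.mpr ⟨hasSum_le (fun i => ?_) h4.neg h3, hasSum_le (fun i => ?_) h3 h4⟩
  · rw [← neg_mul]
    exact mul_le_mul_of_nonneg_right (abs_le.mp (hb _)).1 (hv i)
  · exact mul_le_mul_of_nonneg_right (abs_le.mp (hb _)).2 (hv i)


/-- For `z` on the unit circle and not a root of unity, `x` and `x z^{-g}` cannot both be nearly
purely imaginary, uniformly in `x` of fixed modulus and in `1 ≤ g ≤ K`. -/
theorem exists_uniform_re_bound {z w : ℂ} (hz1 : ‖z‖ = 1) (hroot : ∀ g : ℕ, 0 < g → z ^ g ≠ 1)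
    (hw : w ≠ 0) (K : ℕ) :
    ∃ η : ℝ, 0 < η ∧ ∀ (x : ℂ) (g : ℕ), ‖x‖ = ‖w‖ → 1 ≤ g → g ≤ K → |x.re| < η →
      η ≤ |(x * z⁻¹ ^ g).re| := by
  have him : ∀ g : ℕ, 0 < g → (z⁻¹ ^ g).im ≠ 0 := by
    intro g hg h0
    have hn : ‖z⁻¹ ^ g‖ = 1 := by simp [hz1]
    have h1 := Complex.sq_norm (z⁻¹ ^ g)
    rw [hn, Complex.normSq_apply, h0] at h1
    have h2 : (z⁻¹ ^ g) ^ 2 = 1 := by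
      apply Complex.ext
      · rw [pow_two, Complex.mul_re, h0, Complex.one_re]; linarith
      · rw [pow_two, Complex.mul_im, h0, Complex.one_im]; ring
    rw [← pow_mul, inv_pow, inv_eq_one] at h2
    exact hroot (g * 2) (by omega) h2
  obtain ⟨κ, hκ0, hκ⟩ : ∃ κ : ℝ, 0 < κ ∧ ∀ g : ℕ, 1 ≤ g → g ≤ K → κ ≤ |(z⁻¹ ^ g).im| := by
    rcases Nat.eq_zero_or_pos K with rfl | hK
    · exact ⟨1, one_pos, fun g h1 h2 => by omega⟩
    · obtain ⟨g₀, hg₀, hmin⟩ := (Finset.Icc 1 K).exists_min_image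
        (fun g => |(z⁻¹ ^ g).im|) ⟨1, by simp; omega⟩
      refine ⟨_, abs_pos.mpr (him g₀ (by simp at hg₀; omega)), fun g h1 h2 => ?_⟩
      exact hmin g (by simp; omega)
  have hW : 0 < ‖w‖ := norm_pos_iff.mpr hw
  refine ⟨‖w‖ * κ / 4, by positivity, fun x g hx hg1 hgK hre => ?_⟩
  by_contra! hlt
  have hn : ‖z⁻¹ ^ g‖ = 1 := by simp [hz1]
  have hκ1 : κ ≤ 1 := (hκ g hg1 hgK).trans ((Complex.abs_im_le_norm _).trans hn.le)
  have hre1 : |(z⁻¹ ^ g).re| ≤ 1 := (Complex.abs_re_le_norm _).trans hn.le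
  have hx1 : ‖w‖ ≤ |x.re| + |x.im| := hx ▸ Complex.norm_le_abs_re_add_abs_im x
  have e : x.im * (z⁻¹ ^ g).im = x.re * (z⁻¹ ^ g).re - (x * z⁻¹ ^ g).re := by
    rw [Complex.mul_re]; ring
  have h1 : |x.im| * |(z⁻¹ ^ g).im| ≤ |x.re| * |(z⁻¹ ^ g).re| + |(x * z⁻¹ ^ g).re| := by
    rw [← abs_mul, e, ← abs_mul]
    exact abs_sub _ _
  have h2 : |x.re| * |(z⁻¹ ^ g).re| ≤ |x.re| := mul_le_of_le_one_right (abs_nonneg _) hre1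
  have h3 : |x.im| * κ ≤ |x.im| * |(z⁻¹ ^ g).im| :=
    mul_le_mul_of_nonneg_left (hκ g hg1 hgK) (abs_nonneg _)
  have h4 : (‖w‖ - ‖w‖ * κ / 4) * κ ≤ |x.im| * κ :=
    mul_le_mul_of_nonneg_right (by linarith) hκ0.le
  nlinarith [mul_pos hW hκ0]

/-- Rigidity of sign-coherent expansions. The functional `P ↦ Re (w P(z)) + c P(q)` takes the value
`u_i = Re (w z^{-(i+1)}) + c q^{-(i+1)}` at the position `i`. If it vanishes at `P`, and the digits
`s_i` of an expansion of `P(q)` are such that every product `s_i u_i` is nonpositive, then all these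
products vanish: they sum to `0` up to the functional of a remainder, which lies in a finite set
and is scaled by `z^{-n}`. When `|z| = 1` this scaling gains nothing; there the sum of the
`|s_i u_i|` is bounded, and a remainder that never vanishes would force nonzero digits with bounded
gaps, at positions where `u_i` does not tend to `0`. -/
theorem SeparatedValues.digits_mul_eq_zero {m : ℕ} {q : ℝ} {z : ℂ} (hq : 1 < q)
    (hsep : SeparatedValues (2 * m) q) (hz : ∀ P : ℤ[X], aeval q P = 0 → aeval z P = 0)
    (hz1 : 1 ≤ ‖z‖) (hroot : ∀ g : ℕ, 0 < g → z ^ g ≠ 1) {w : ℂ} (hw : w ≠ 0) {c : ℝ}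
    {P : ℤ[X]} (hP : HeightLE m P) (hP0 : (w * aeval z P).re + c * aeval q P = 0)
    {s : ℕ → ℤ} (hs : ∀ i, |s i| ≤ m)
    (hsum : HasSum (fun i => (s i : ℝ) * q⁻¹ ^ (i + 1)) (aeval q P))
    (hsign : ∀ i, s i * ((w * z⁻¹ ^ (i + 1)).re + c * q⁻¹ ^ (i + 1)) ≤ 0) (j : ℕ) :
    s j * ((w * z⁻¹ ^ (j + 1)).re + c * q⁻¹ ^ (j + 1)) = 0 := by
  have hq0 : 0 < q := by linarith
  have hz0 : z ≠ 0 := by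
    rintro rfl
    norm_num at hz1
  set u : ℕ → ℝ := fun i => (w * z⁻¹ ^ (i + 1)).re + c * q⁻¹ ^ (i + 1) with hu
  set R := remainderPoly P s with hR
  have hRq : ∀ n, |aeval q (R n)| ≤ m / (q - 1) := abs_aeval_remainderPoly_le hq hs hsum
  obtain ⟨B, hB⟩ := hsep.exists_bound hz (m / (q - 1))
  have hRz : ∀ n, ‖aeval z (R n)‖ ≤ B := fun n => hB _ (hP.remainderPoly hs n) (hRq n)
  have hvq : ∀ n : ℕ, 0 < q⁻¹ ^ n := fun n => by positivity
  -- the partial sums of the nonpositive terms are minus the functional at the remainders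
  set E : ℕ → ℝ := fun n =>
    (w * (z⁻¹ ^ n * aeval z (R n))).re + c * (q⁻¹ ^ n * aeval q (R n)) with hE
  have hsumE : ∀ n, ∑ i ∈ Finset.range n, s i * u i = -E n := by
    intro n
    have h1 := sum_eq_sub_remainderPoly hz0 P s n
    have h2 := sum_eq_sub_remainderPoly hq0.ne' P s n
    have h3 : ∑ i ∈ Finset.range n, s i * u i
        = (w * ∑ i ∈ Finset.range n, (s i : ℂ) * z⁻¹ ^ (i + 1)).re
          + c * ∑ i ∈ Finset.range n, (s i : ℝ) * q⁻¹ ^ (i + 1) := by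
      rw [Finset.mul_sum, Complex.re_sum, Finset.mul_sum, ← Finset.sum_add_distrib]
      refine Finset.sum_congr rfl fun i _ => ?_
      have : w * ((s i : ℂ) * z⁻¹ ^ (i + 1)) = ((s i : ℝ) : ℂ) * (w * z⁻¹ ^ (i + 1)) := by
        push_cast; ring
      rw [this, Complex.re_ofReal_mul, hu]
      ring
    rw [h3, h1, h2, mul_sub, Complex.sub_re, mul_sub, hE]
    linarith
  have hmono : ∀ n, j < n → -E n ≤ s j * u j := by
    intro n hn
    rw [← hsumE, ← Finset.sum_erase_add _ _ (Finset.mem_range.mpr hn)]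
    have : ∑ i ∈ (Finset.range n).erase j, s i * u i ≤ 0 :=
      Finset.sum_nonpos fun i _ => hsign i
    linarith
  have hEbound : ∀ n, E n ≤ ‖w‖ * (‖z‖⁻¹ ^ n * B) + |c| * (q⁻¹ ^ n * (m / (q - 1))) := by
    intro n
    refine add_le_add ?_ ?_
    · refine (Complex.re_le_norm _).trans ?_
      rw [norm_mul, norm_mul, norm_pow, norm_inv]
      have := hRz n
      gcongr
    · refine (le_abs_self _).trans ?_
      rw [abs_mul, abs_mul, abs_of_pos (hvq n)]
      have := hRq n
      have := hvq n
      gcongr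
  have hqlim : Tendsto (fun n : ℕ => q⁻¹ ^ n) atTop (nhds 0) :=
    tendsto_pow_atTop_nhds_zero_of_lt_one (by positivity) (inv_lt_one_of_one_lt₀ hq)
  refine le_antisymm (hsign j) ?_
  rcases hz1.lt_or_eq with hlt | heq
  · -- off the unit circle the remainders are negligible
    have hzlim : Tendsto (fun n : ℕ => ‖z‖⁻¹ ^ n) atTop (nhds 0) :=
      tendsto_pow_atTop_nhds_zero_of_lt_one (by positivity) (inv_lt_one_of_one_lt₀ hlt)
    have hlim := (((hzlim.mul_const B).const_mul ‖w‖).add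
      ((hqlim.mul_const (m / (q - 1))).const_mul |c|)).neg
    simp only [zero_mul, mul_zero, add_zero, neg_zero] at hlim
    refine le_of_tendsto hlim ?_
    filter_upwards [eventually_gt_atTop j] with n hn
    linarith [hmono n hn, hEbound n]
  · -- on the unit circle the remainder must vanish infinitely often
    suffices h : ∃ n, j < n ∧ aeval q (R n) = 0 by
      obtain ⟨n, hn, h0⟩ := h
      have hE0 : E n = 0 := by simp [hE, h0, hz _ h0]
      linarith [hmono n hn]
    by_contra! hne
    obtain ⟨δ, hδ, hsep'⟩ := hsep.mono (by omega : m ≤ 2 * m)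
    -- a run of `K` vanishing digits would push the remainder out of its bounds
    obtain ⟨K, hK⟩ := pow_unbounded_of_one_lt (m / (q - 1) / δ) hq
    rw [div_lt_iff₀ hδ] at hK
    have hwin : ∀ n, j < n → ∃ i, n ≤ i ∧ i < n + K ∧ s i ≠ 0 := by
      intro n hn
      by_contra! hzero
      have hgrow : ∀ k, k ≤ K → aeval q (R (n + k)) = q ^ k * aeval q (R n) := by
        intro k hk
        induction k with
        | zero => simp
        | succ k ih =>
          have e : R (n + (k + 1)) = X * R (n + k) - C (s (n + k)) := rfl
          rw [e, hzero (n + k) (by omega) (by omega), map_sub, map_mul, aeval_X,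
            ih (by omega)]
          simp
          ring
      have h1 := hRq (n + K)
      rw [hgrow K le_rfl, abs_mul, abs_of_pos (by positivity)] at h1
      have h2 := hsep' _ (hP.remainderPoly hs n) (hne n hn)
      have h3 : q ^ K * δ ≤ q ^ K * |aeval q (R n)| := by gcongr
      linarith
    obtain ⟨η, hη, hre⟩ := exists_uniform_re_bound heq.symm hroot hw K
    have hsummable : Summable fun i => -(s i * u i) := by
      refine summable_of_sum_range_le (c := ‖w‖ * B + |c| * (m / (q - 1)))
        (fun i => by linarith [hsign i]) fun n => ?_
      rw [Finset.sum_neg_distrib, hsumE, neg_neg]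
      refine (hEbound n).trans ?_
      have hM : 0 ≤ m / (q - 1) := (abs_nonneg _).trans (hRq 0)
      have h1 : q⁻¹ ^ n ≤ 1 := pow_le_one₀ (by positivity) (inv_le_one_of_one_le₀ hq.le)
      rw [← heq, inv_one, one_pow, one_mul]
      gcongr
      exact mul_le_of_le_one_left hM h1
    have hlim1 := hsummable.tendsto_atTop_zero
    have hlim2 : Tendsto (fun n : ℕ => |c| * q⁻¹ ^ (n + 1)) atTop (nhds 0) := by
      simpa using (hqlim.comp (tendsto_add_atTop_nat 1)).const_mul |c|
    obtain ⟨N, hN⟩ := eventually_atTop.mp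
      ((hlim1.eventually_lt_const (half_pos hη)).and (hlim2.eventually_lt_const (half_pos hη)))
    have hsmall : ∀ i, N ≤ i → s i ≠ 0 → |(w * z⁻¹ ^ (i + 1)).re| < η := by
      intro i hi hsi
      obtain ⟨h1, h2⟩ := hN i hi
      have h3 : (1 : ℝ) ≤ |(s i : ℝ)| := by exact_mod_cast Int.one_le_abs hsi
      have h4 : |u i| ≤ -(s i * u i) := by
        rw [← abs_of_nonpos (hsign i), abs_mul]
        exact le_mul_of_one_le_left (abs_nonneg _) h3
      have h5 : |(w * z⁻¹ ^ (i + 1)).re| ≤ |u i| + |c| * q⁻¹ ^ (i + 1) := by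
        have : (w * z⁻¹ ^ (i + 1)).re = u i - c * q⁻¹ ^ (i + 1) := by simp [hu]
        rw [this]
        refine (abs_sub _ _).trans ?_
        rw [abs_mul, abs_of_pos (hvq _)]
      linarith
    obtain ⟨i, hi1, -, hsi⟩ := hwin (max N (j + 1)) (by omega)
    obtain ⟨k, hk1, hk2, hsk⟩ := hwin (i + 1) (by omega)
    have h1 := hre (w * z⁻¹ ^ (i + 1)) (k - i) (by simp [← heq]) (by omega) (by omega)
      (hsmall i (by omega) hsi)
    rw [mul_assoc, ← pow_add, show i + 1 + (k - i) = k + 1 by omega] at h1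
    exact absurd (hsmall k (by omega) hsk) (not_lt.mpr h1)


/-! ### Small values of the spectrum -/

/-- A direction `w` for which no nonzero `w * f i` is purely imaginary, normalised at `i = 0` by
changing the sign of `w`. Each index excludes one real number `x` from `w = 1 + x i`. -/
theorem exists_generic_direction (f : ℕ → ℂ) :
    ∃ w : ℂ, w ≠ 0 ∧ 0 ≤ (w * f 0).re ∧ ∀ i, f i ≠ 0 → (w * f i).re ≠ 0 := by
  obtain ⟨x, hx⟩ := ((Set.countable_range fun i => (f i).re / (f i).im).dense_compl ℝ).nonempty
  have hw : ∀ i, f i ≠ 0 → ((⟨1, x⟩ : ℂ) * f i).re ≠ 0 := by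
    intro i hi h0
    rw [Complex.mul_re] at h0
    dsimp only at h0
    have him : (f i).im ≠ 0 := by
      intro h
      rw [h] at h0
      exact hi (Complex.ext (by simpa using h0) h)
    refine hx ⟨i, ?_⟩
    dsimp only
    rw [div_eq_iff him]
    linarith
  have hne : (⟨1, x⟩ : ℂ) ≠ 0 := fun h => by simpa using congrArg Complex.re h
  rcases le_total 0 ((⟨1, x⟩ : ℂ) * f 0).re with h | h
  · exact ⟨_, hne, h, hw⟩
  · refine ⟨-⟨1, x⟩, neg_ne_zero.mpr hne, ?_, fun i hi => ?_⟩
    · rw [neg_mul, Complex.neg_re]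
      linarith
    · rw [neg_mul, Complex.neg_re]
      exact neg_ne_zero.mpr (hw i hi)

/-- Every small positive value `d = P(q)` is of the form `k / q`. With `θ = P(z) / d` and
`ρ = q / z`, the functional vanishing at `P` attached to a direction `w` takes at the position `i`
a value of the same sign as `Re (w (ρ ^ (i + 1) - θ))`. Let `t` have the digit `m` at the first
position and wherever this sign is positive, and `0` elsewhere. Then `t ≥ m / q ≥ d`, and comparing
the digits of `t` with those of `t - d` gives a sign-coherent expansion of `-d`. By rigidity it is
supported where the functional vanishes; as `-d` is negative, this includes the first position, so
that `θ = ρ`, and then no other position qualifies. -/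
theorem SeparatedValues.eq_natCast_of_le_half {m : ℕ} {q : ℝ} {z : ℂ} (hq : 1 < q)
    (hm : q ≤ m + 1) (hsep : SeparatedValues (2 * m) q)
    (hz : ∀ P : ℤ[X], aeval q P = 0 → aeval z P = 0)
    (hz1 : 1 ≤ ‖z‖) (hroot : ∀ g : ℕ, 0 < g → z ^ g ≠ 1)
    (hratio : ∀ g : ℕ, 0 < g → z ^ g ≠ (q : ℂ) ^ g)
    {P : ℤ[X]} (hP : HeightLE m P) (hd0 : 0 < aeval q P) (hd1 : aeval q P ≤ 1 / 2) :
    ∃ k : ℕ, k ≤ m ∧ q * aeval q P = k := by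
  have hq0 : 0 < q := by linarith
  have hqC : (q : ℂ) ≠ 0 := by exact_mod_cast hq0.ne'
  have hz0 : z ≠ 0 := by
    rintro rfl
    norm_num at hz1
  have hm1 : (1 : ℝ) ≤ m := by
    rw [Nat.one_le_cast, Nat.one_le_iff_ne_zero]
    rintro rfl
    norm_num at hm
    linarith
  set d := aeval q P with hd
  set ρ : ℂ := q * z⁻¹ with hρ
  set θ : ℂ := aeval z P / (d : ℂ) with hθ
  have hdC : (d : ℂ) ≠ 0 := by exact_mod_cast hd0.ne'
  obtain ⟨w, hw, hw0, hgen⟩ := exists_generic_direction fun i => ρ ^ (i + 1) - θ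
  -- this choice of `c` makes the functional vanish at `P`
  set c : ℝ := -(w * θ).re with hc
  set u : ℕ → ℝ := fun i => (w * z⁻¹ ^ (i + 1)).re + c * q⁻¹ ^ (i + 1) with hu
  have hu' : ∀ i, u i = q⁻¹ ^ (i + 1) * (w * (ρ ^ (i + 1) - θ)).re := by
    intro i
    have e : w * z⁻¹ ^ (i + 1) = ((q⁻¹ ^ (i + 1) : ℝ) : ℂ) * (w * ρ ^ (i + 1)) := by
      rw [hρ, mul_pow]
      push_cast
      have : ((q : ℂ)⁻¹) ^ (i + 1) * (q : ℂ) ^ (i + 1) = 1 := by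
        rw [← mul_pow, inv_mul_cancel₀ hqC, one_pow]
      linear_combination (-w * z⁻¹ ^ (i + 1)) * this
    simp only [hu]
    rw [e, Complex.re_ofReal_mul, mul_sub, Complex.sub_re, hc]
    ring
  have hv : ∀ i : ℕ, 0 < q⁻¹ ^ (i + 1) := fun i => by positivity
  have hu0 : 0 ≤ u 0 := by
    rw [hu']
    exact mul_nonneg (hv 0).le hw0
  set a : ℕ → ℕ := fun i => if 0 < u i ∨ i = 0 then m else 0 with ha
  have ham : ∀ i, a i ≤ m := fun i => by
    simp only [ha]
    split_ifs <;> omega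
  have hMsum := (hasSum_inv_pow_succ hq).mul_left (m : ℝ)
  rw [mul_one_div] at hMsum
  have hale : ∀ i, (a i : ℝ) * q⁻¹ ^ (i + 1) ≤ m * q⁻¹ ^ (i + 1) := fun i =>
    mul_le_mul_of_nonneg_right (by exact_mod_cast ham i) (hv i).le
  obtain ⟨t, ht⟩ : Summable fun i => (a i : ℝ) * q⁻¹ ^ (i + 1) :=
    Summable.of_nonneg_of_le (fun i => by positivity) hale hMsum.summable
  have htM : t ≤ m / (q - 1) := hasSum_le hale ht hMsum
  have htd : d ≤ t := by
    have h1 := le_hasSum ht 0 fun i _ => by positivity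
    have h2 : a 0 = m := by simp [ha]
    rw [h2, zero_add, pow_one, ← div_eq_mul_inv, div_le_iff₀ hq0] at h1
    nlinarith
  obtain ⟨b, hbm, hb⟩ := exists_expansion hq hm (sub_nonneg.mpr htd) (by linarith)
  set s : ℕ → ℤ := fun i => (b i : ℤ) - a i with hs
  have hsm : ∀ i, |s i| ≤ m := fun i => by
    have h1 := ham i
    have h2 := hbm i
    rw [abs_le]
    simp only [hs]
    constructor <;> omega
  have hssum : HasSum (fun i => (s i : ℝ) * q⁻¹ ^ (i + 1)) (-d) := by
    have h := hb.sub ht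
    rw [sub_sub_cancel_left] at h
    simpa only [hs, ← sub_mul, Int.cast_sub, Int.cast_natCast] using h
  have hsign : ∀ i, s i * u i ≤ 0 := by
    intro i
    by_cases hi : 0 < u i ∨ i = 0
    · have hui : 0 ≤ u i := by
        rcases hi with h | rfl
        exacts [h.le, hu0]
      have hsi : s i ≤ 0 := by
        have := hbm i
        simp only [hs, ha, if_pos hi]
        omega
      exact mul_nonpos_of_nonpos_of_nonneg (by exact_mod_cast hsi) hui
    · have hui : u i ≤ 0 := by
        by_contra h
        exact hi (Or.inl (not_le.mp h))
      have hsi : 0 ≤ s i := by simp [hs, ha, if_neg hi]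
      exact mul_nonpos_of_nonneg_of_nonpos (by exact_mod_cast hsi) hui
  have hfun : (w * aeval z (-P)).re + c * aeval q (-P) = 0 := by
    have e : w * aeval z P = (d : ℂ) * (w * θ) := by
      rw [hθ]
      field_simp
    rw [map_neg, map_neg, mul_neg, Complex.neg_re, e, Complex.re_ofReal_mul, hc, ← hd]
    ring
  have hrigid := hsep.digits_mul_eq_zero hq hz hz1 hroot hw hP.neg hfun hsm
    (by rwa [map_neg]) hsign
  have hs0 : ∀ i, u i ≠ 0 → s i = 0 := fun i hi => by
    rcases mul_eq_zero.mp (hrigid i) with h | h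
    · exact_mod_cast h
    · exact absurd h hi
  have huz : ∀ i, ρ ^ (i + 1) ≠ θ → u i ≠ 0 := fun i hi => by
    rw [hu']
    exact mul_ne_zero (hv i).ne' (hgen i (sub_ne_zero.mpr hi))
  have hspos : ∀ i, i ≠ 0 → 0 ≤ s i := by
    intro i hi
    by_cases h : 0 < u i
    · exact (hs0 i h.ne').ge
    · simp [hs, ha, h, hi]
  by_cases hρθ : ρ = θ
  · -- only the first digit can differ
    have htail : ∀ i, i ≠ 0 → s i = 0 := by
      intro i hi
      refine hs0 i (huz i fun h => ?_)
      rw [← hρθ, pow_succ] at h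
      have hρ0 : ρ ≠ 0 := mul_ne_zero hqC (inv_ne_zero hz0)
      have h1 : ρ ^ i = 1 := mul_right_cancel₀ hρ0 (by rw [h, one_mul])
      rw [hρ, mul_pow, inv_pow, mul_inv_eq_one₀ (pow_ne_zero _ hz0)] at h1
      exact hratio i (Nat.pos_of_ne_zero hi) h1.symm
    have h1 := hasSum_single (f := fun i => (s i : ℝ) * q⁻¹ ^ (i + 1)) 0
      (fun i hi => by simp [htail i hi])
    have h2 := hssum.unique h1
    refine ⟨m - b 0, by omega, ?_⟩
    have h3 : s 0 = (b 0 : ℤ) - m := by simp [hs, ha]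
    rw [h3, zero_add, pow_one] at h2
    rw [Nat.cast_sub (hbm 0)]
    field_simp at h2
    push_cast at h2
    linarith
  · have h0 : s 0 = 0 := hs0 0 (huz 0 (by rwa [zero_add, pow_one]))
    have h1 : 0 ≤ -d := hssum.nonneg fun i => by
      rcases eq_or_ne i 0 with rfl | hi
      · simp [h0]
      · exact mul_nonneg (by exact_mod_cast hspos i hi) (hv i).le
    linarith

/-- No other conjugate has modulus `q`: apply rigidity to the functional `Re P(z) - P(q)`, which
vanishes at `P = 1` and is nonpositive at every position, and to an expansion of `1` whose first
digit is `m`. -/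
theorem SeparatedValues.norm_ne {m : ℕ} {q : ℝ} {z : ℂ} (hq : 1 < q) (hmq : m < q)
    (hm : q < m + 1) (hsep : SeparatedValues (2 * m) q)
    (hz : ∀ P : ℤ[X], aeval q P = 0 → aeval z P = 0)
    (hz1 : 1 ≤ ‖z‖) (hroot : ∀ g : ℕ, 0 < g → z ^ g ≠ 1) (hzq : z ≠ q) : ‖z‖ ≠ q := by
  intro hnorm
  have hq0 : 0 < q := by linarith
  have hm0 : m ≠ 0 := by
    rintro rfl
    norm_num at hm
    linarith
  have hM : 1 ≤ m / (q - 1) := by rw [le_div_iff₀ (by linarith)]; linarith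
  obtain ⟨b, hbm, hb⟩ := exists_expansion hq hm.le (t := q - m) (by linarith) (by linarith)
  obtain ⟨s, hsz, hs1⟩ : ∃ s : ℕ → ℤ, s 0 = m ∧ ∀ i, s (i + 1) = b i :=
    ⟨fun i => Nat.casesOn i m fun n => b n, rfl, fun _ => rfl⟩
  have hs0 : ∀ i, 0 ≤ s i := by
    rintro (_ | i)
    · rw [hsz]; positivity
    · rw [hs1]; positivity
  have hsm : ∀ i, |s i| ≤ m := by
    intro i
    rw [abs_of_nonneg (hs0 i)]
    rcases i with _ | i
    · rw [hsz]
    · rw [hs1]; exact_mod_cast hbm i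
  have hsum : HasSum (fun i => (s i : ℝ) * q⁻¹ ^ (i + 1)) (aeval q (1 : ℤ[X])) := by
    have h := hb.mul_right q⁻¹
    have e : aeval q (1 : ℤ[X])
        = (q - m) * q⁻¹ + ∑ i ∈ Finset.range 1, (s i : ℝ) * q⁻¹ ^ (i + 1) := by
      rw [Finset.sum_range_one, hsz, map_one]
      push_cast
      field_simp
      ring
    rw [e, ← hasSum_nat_add_iff (f := fun i => (s i : ℝ) * q⁻¹ ^ (i + 1)) 1]
    simpa only [hs1, Int.cast_natCast, pow_succ q⁻¹ (_ + 1), mul_assoc] using h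
  have hre : ∀ i : ℕ, (1 * z⁻¹ ^ (i + 1)).re + -1 * q⁻¹ ^ (i + 1) ≤ 0 := by
    intro i
    have := Complex.re_le_norm (z⁻¹ ^ (i + 1))
    rw [norm_pow, norm_inv, hnorm] at this
    rw [one_mul]
    linarith
  have h := hsep.digits_mul_eq_zero hq hz hz1 hroot one_ne_zero (c := -1)
    (heightLE_one (Nat.one_le_iff_ne_zero.mpr hm0)) (by simp) hsm hsum
    (fun i => mul_nonpos_of_nonneg_of_nonpos (by exact_mod_cast hs0 i) (hre i)) 0
  have h1 : (z⁻¹).re = q⁻¹ := by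
    rcases mul_eq_zero.mp h with h | h
    · exact absurd h (by rw [hsz]; exact_mod_cast hm0)
    · simp only [one_mul, zero_add, pow_one] at h
      linarith
  have h2 : ‖z⁻¹‖ = q⁻¹ := by rw [norm_inv, hnorm]
  have h3 : z⁻¹ = (q⁻¹ : ℝ) := by
    rw [← h1]
    refine (Complex.re_eq_norm.mp (h1.trans h2.symm) |> Complex.nonneg_iff.mp |>.2 |> fun h =>
      Complex.ext (by simp) (by simpa using h.symm))
  refine hzq ?_
  rw [← inv_inv z, h3]
  push_cast
  rw [inv_inv]

/-! ### Excluding conjugates outside the unit disc -/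

/-- The given polynomial is `(x - 1)` times `x ^ (k + 1) - m (x ^ k + ⋯ + x) - s`, which by a
classical result of Brauer has `q` as its only root outside the open unit disc. In terms of
`u = 1 / z` and `v = 1 / q`, the divided difference at `v` of `(m - s) x ^ (k + 1) + s x ^ (k + 2)`
has nonnegative coefficients and the same value at `u` and at `1`; as `|u| ≤ 1`, this makes every
contributing power of `u`, including the first, equal to `1`. -/
theorem eq_or_eq_one_of_root {m s k : ℕ} {q : ℝ} {z : ℂ} (hq : 1 < q) (hz1 : 1 ≤ ‖z‖)
    (hm : 1 ≤ m) (hs : s ≤ m) (hk : 1 ≤ k)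
    (hqe : q ^ (k + 2) - (m + 1) * q ^ (k + 1) + (m - s) * q + s = 0)
    (hze : z ^ (k + 2) - (m + 1) * z ^ (k + 1) + (m - s) * z + s = 0) : z = q ∨ z = 1 := by
  by_contra! hne
  obtain ⟨hzq, hz_one⟩ := hne
  have hq0 : 0 < q := by linarith
  have hz0 : z ≠ 0 := by
    rintro rfl
    norm_num at hz1
  set u : ℂ := z⁻¹ with hu
  set v : ℝ := q⁻¹ with hv
  have hv0 : 0 < v := by positivity
  have hun : ‖u‖ ≤ 1 := by
    rw [hu, norm_inv]
    exact inv_le_one_of_one_le₀ hz1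
  have hve : 1 - (m + 1) * v + (m - s) * v ^ (k + 1) + s * v ^ (k + 2) = 0 := by
    have h : q * v = 1 := mul_inv_cancel₀ hq0.ne'
    have h1 : q ^ (k + 1) * v ^ (k + 1) = 1 := by rw [← mul_pow, h, one_pow]
    have h2 : q ^ (k + 2) * v ^ (k + 2) = 1 := by rw [← mul_pow, h, one_pow]
    linear_combination v ^ (k + 2) * hqe - h2 + (m + 1) * v * h1 - (m - s) * v ^ (k + 1) * h
  have hue : 1 - (m + 1) * u + (m - s) * u ^ (k + 1) + s * u ^ (k + 2) = 0 := by
    have h : z * u = 1 := mul_inv_cancel₀ hz0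
    have h1 : z ^ (k + 1) * u ^ (k + 1) = 1 := by rw [← mul_pow, h, one_pow]
    have h2 : z ^ (k + 2) * u ^ (k + 2) = 1 := by rw [← mul_pow, h, one_pow]
    linear_combination u ^ (k + 2) * hze - h2 + (m + 1) * u * h1 - (m - s) * u ^ (k + 1) * h
  have hveC : (1 : ℂ) - (m + 1) * v + (m - s) * v ^ (k + 1) + s * v ^ (k + 2) = 0 := by
    exact_mod_cast hve
  have huv : u - v ≠ 0 := by
    rw [sub_ne_zero, hu, hv]
    intro h
    apply hzq
    rw [← inv_inv z, h]
    simp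
  have h1v : (1 : ℂ) - v ≠ 0 := by
    rw [sub_ne_zero]
    intro h
    have : v < 1 := inv_lt_one_of_one_lt₀ hq
    exact this.ne' (by exact_mod_cast h)
  -- the divided difference at `v` takes the same value at the roots `u` and `1`
  set F : ℂ → ℂ := fun x => (m - s) * ∑ i ∈ Finset.range (k + 1), x ^ i * (v : ℂ) ^ (k + 1 - 1 - i)
    + s * ∑ i ∈ Finset.range (k + 2), x ^ i * (v : ℂ) ^ (k + 2 - 1 - i) with hF
  have hFmul : ∀ x, F x * (x - v)
      = (m - s) * (x ^ (k + 1) - (v : ℂ) ^ (k + 1)) + s * (x ^ (k + 2) - (v : ℂ) ^ (k + 2)) := by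
    intro x
    rw [← geom_sum₂_mul, ← geom_sum₂_mul, hF]
    ring
  have hFu : F u = m + 1 := by
    refine mul_right_cancel₀ huv ?_
    rw [hFmul]
    linear_combination hue - hveC
  have hF1 : F 1 = m + 1 := by
    refine mul_right_cancel₀ h1v ?_
    rw [hFmul]
    linear_combination -hveC
  have hg : ∀ i, 0 ≤ 1 - (u ^ i).re := fun i => by
    have h1 := Complex.re_le_norm (u ^ i)
    rw [norm_pow] at h1
    have h2 : ‖u‖ ^ i ≤ 1 := pow_le_one₀ (norm_nonneg _) hun
    linarith
  have hsum : (m - s : ℝ) * ∑ i ∈ Finset.range (k + 1), (1 - (u ^ i).re) * v ^ (k + 1 - 1 - i)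
      + s * ∑ i ∈ Finset.range (k + 2), (1 - (u ^ i).re) * v ^ (k + 2 - 1 - i) = 0 := by
    have hre : ∀ (n : ℕ), (∑ i ∈ Finset.range n, (1 : ℂ) ^ i * (v : ℂ) ^ (n - 1 - i)
        - ∑ i ∈ Finset.range n, u ^ i * (v : ℂ) ^ (n - 1 - i)).re
        = ∑ i ∈ Finset.range n, (1 - (u ^ i).re) * v ^ (n - 1 - i) := by
      intro n
      rw [← Finset.sum_sub_distrib, Complex.re_sum]
      refine Finset.sum_congr rfl fun i _ => ?_
      rw [one_pow, ← sub_mul, ← Complex.ofReal_pow, Complex.re_mul_ofReal, Complex.sub_re,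
        Complex.one_re]
    have h0 : F 1 - F u = 0 := by rw [hF1, hFu, sub_self]
    have h1 : F 1 - F u = ((m - s : ℝ) : ℂ) * (∑ i ∈ Finset.range (k + 1),
          (1 : ℂ) ^ i * (v : ℂ) ^ (k + 1 - 1 - i)
          - ∑ i ∈ Finset.range (k + 1), u ^ i * (v : ℂ) ^ (k + 1 - 1 - i))
        + ((s : ℝ) : ℂ) * (∑ i ∈ Finset.range (k + 2), (1 : ℂ) ^ i * (v : ℂ) ^ (k + 2 - 1 - i)
          - ∑ i ∈ Finset.range (k + 2), u ^ i * (v : ℂ) ^ (k + 2 - 1 - i)) := by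
      rw [hF]
      push_cast
      ring
    rw [h0] at h1
    have h2 := congrArg Complex.re h1
    rw [Complex.add_re, Complex.re_ofReal_mul, Complex.re_ofReal_mul, hre, hre] at h2
    exact h2.symm
  have hsR : (s : ℝ) ≤ m := by exact_mod_cast hs
  have hS1 : (1 - u.re) * v ^ (k + 1 - 1 - 1)
      ≤ ∑ i ∈ Finset.range (k + 1), (1 - (u ^ i).re) * v ^ (k + 1 - 1 - i) := by
    have := Finset.single_le_sum (f := fun i => (1 - (u ^ i).re) * v ^ (k + 1 - 1 - i))
      (s := Finset.range (k + 1)) (fun i _ => mul_nonneg (hg i) (by positivity))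
      (a := 1) (by simp; omega)
    simpa using this
  have hS2 : (1 - u.re) * v ^ (k + 2 - 1 - 1)
      ≤ ∑ i ∈ Finset.range (k + 2), (1 - (u ^ i).re) * v ^ (k + 2 - 1 - i) := by
    have := Finset.single_le_sum (f := fun i => (1 - (u ^ i).re) * v ^ (k + 2 - 1 - i))
      (s := Finset.range (k + 2)) (fun i _ => mul_nonneg (hg i) (by positivity))
      (a := 1) (by simp)
    simpa using this
  have hcoef : 0 < (m - s : ℝ) * v ^ (k + 1 - 1 - 1) + s * v ^ (k + 2 - 1 - 1) := by
    have hm0 : (1 : ℝ) ≤ m := by exact_mod_cast hm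
    rcases hs.lt_or_eq with h | h
    · have : (0 : ℝ) < m - s := by
        have : (s : ℝ) < m := by exact_mod_cast h
        linarith
      positivity
    · have : (0 : ℝ) < s := by
        rw [h]
        linarith
      have h2 : (0 : ℝ) ≤ m - s := by linarith
      positivity
  have hre1 : u.re = 1 := by
    have h1 := hg 1
    rw [pow_one] at h1
    have h2 := mul_le_mul_of_nonneg_left hS1 (by linarith : (0 : ℝ) ≤ m - s)
    have h3 := mul_le_mul_of_nonneg_left hS2 (Nat.cast_nonneg s)
    by_contra h
    have h4 : 0 < 1 - u.re := lt_of_le_of_ne h1 fun h' => h (by linarith)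
    have := mul_pos h4 hcoef
    linarith
  have hu1 : u = 1 := by
    have h1 := Complex.sq_norm u
    rw [Complex.normSq_apply, hre1] at h1
    have h2 : ‖u‖ ^ 2 ≤ 1 := pow_le_one₀ (norm_nonneg _) hun
    refine Complex.ext (by simpa using hre1) ?_
    have : u.im * u.im ≤ 0 := by linarith
    simpa using mul_self_eq_zero.mp (le_antisymm this (mul_self_nonneg _))
  rw [hu, inv_eq_one] at hu1
  exact hz_one hu1

/-- Separated values are incompatible with a conjugate `z ≠ q` outside the open unit disc. Starting
from `y_0 = 1`, the values `y_{k+1} = q y_k - m` all belong to the spectrum. As long as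
`y_k > 1/2` and `q y_k > m + 1/2`, also `y_{k+1} > 1/2`. When the second inequality fails, subtract
from `q y_k` the nearest digit `s`: the difference is `0` or `± r / q` with an integer `r`. Either
this gives a finite expansion of `1` with digits `m, …, m` and one further digit, or replacing `s` by a neighbouring
digit shows that `m + 1 - q` belongs to the spectrum; both are impossible. Hence `y_k > 1/2` for
all `k`, although `y_k` tends to `-∞`. -/
theorem SeparatedValues.false_of_conjugate {m : ℕ} {q : ℝ} {z : ℂ} (hq : 1 < q) (hmq : m < q)
    (hm : q < m + 1) (hsep : SeparatedValues (2 * m) q)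
    (hz : ∀ P : ℤ[X], aeval q P = 0 → aeval z P = 0)
    (hz1 : 1 ≤ ‖z‖) (hroot : ∀ g : ℕ, 0 < g → z ^ g ≠ 1) (hzq : z ≠ q) : False := by
  have hm1 : 1 ≤ m := by
    rw [Nat.one_le_iff_ne_zero]
    rintro rfl
    norm_num at hm
    linarith
  have hm1R : (1 : ℝ) ≤ m := by exact_mod_cast hm1
  have hq0 : 0 < q := by linarith
  have hratio : ∀ g : ℕ, 0 < g → z ^ g ≠ (q : ℂ) ^ g := by
    intro g hg h
    have h1 := congrArg norm h
    rw [norm_pow, norm_pow, Complex.norm_real, Real.norm_of_nonneg hq0.le] at h1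
    exact hsep.norm_ne hq hmq hm hz hz1 hroot hzq
      ((pow_left_inj₀ (norm_nonneg _) hq0.le hg.ne').mp h1)
  set Y : Set ℝ := {y | ∃ P : ℤ[X], HeightLE m P ∧ aeval q P = y} with hY
  have hYone : (1 : ℝ) ∈ Y := ⟨1, heightLE_one hm1, map_one _⟩
  have hYneg : ∀ y ∈ Y, -y ∈ Y := by
    rintro _ ⟨P, hP, rfl⟩
    exact ⟨-P, hP.neg, map_neg _ _⟩
  have hYstep : ∀ y ∈ Y, ∀ s : ℤ, |s| ≤ m → q * y - s ∈ Y := by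
    rintro _ ⟨P, hP, rfl⟩ s hs
    exact ⟨X * P - C s, hP.X_mul_sub_C hs, by simp⟩
  have hsmall : ∀ y ∈ Y, 0 < y → y ≤ 1 / 2 → ∃ k : ℕ, k ≤ m ∧ q * y = k := by
    rintro _ ⟨P, hP, rfl⟩ h0 h1
    exact hsep.eq_natCast_of_le_half hq hm.le hz hz1 hroot hratio hP h0 h1
  -- `1` has no finite expansion with digits `m, …, m, s`
  have hbrauer : ∀ k s : ℕ, 1 ≤ k → s ≤ m →
      q ^ (k + 2) - (m + 1) * q ^ (k + 1) + (m - s) * q + s ≠ 0 := by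
    intro k s hk hs h
    have hzr := hz (X ^ (k + 2) - (C (m : ℤ) + 1) * X ^ (k + 1) + (C (m : ℤ) - C (s : ℤ)) * X
      + C (s : ℤ)) (by simpa using h)
    rcases eq_or_eq_one_of_root hq hz1 hm1 hs hk h (by simpa using hzr) with h | h
    · exact hzq h
    · exact hroot 1 one_pos (by rw [h, one_pow])
  -- if `m + 1 - q = k / q` then the conjugate `z` is `m + 1 - q`, inside the unit disc
  have hη : m + 1 - q ∈ Y → 1 / 2 < m + 1 - q := by
    intro hmem
    by_contra! hle
    obtain ⟨k, -, hk⟩ := hsmall _ hmem (by linarith) hle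
    have hzr := hz (X ^ 2 - (C (m : ℤ) + 1) * X + C (k : ℤ)) (by
      simp only [map_add, map_sub, map_mul, map_pow, aeval_X, map_one, map_natCast]
      linarith)
    simp only [map_add, map_sub, map_mul, map_pow, aeval_X, map_one, map_natCast] at hzr
    have hkC : (q : ℂ) * (m + 1 - q) = k := by exact_mod_cast hk
    have hfac : (z - q) * (z - (m + 1 - q)) = 0 := by linear_combination hzr + hkC
    rcases mul_eq_zero.mp hfac with h | h
    · exact hzq (sub_eq_zero.mp h)
    · have h1 : z = ((m + 1 - q : ℝ) : ℂ) := by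
        push_cast
        exact sub_eq_zero.mp h
      rw [h1, Complex.norm_real, Real.norm_of_nonneg (by linarith)] at hz1
      linarith
  have hq1 : q - 1 ≠ 0 := by linarith
  -- the solution of `y_{k+1} = q y_k - m` with `y_0 = 1`
  set y : ℕ → ℝ := fun k => (m - (m + 1 - q) * q ^ k) / (q - 1) with hy
  have hy0 : y 0 = 1 := by
    simp only [hy, pow_zero]
    field_simp
    ring
  have hysucc : ∀ k, y (k + 1) = q * y k - m := by
    intro k
    simp only [hy]
    field_simp
    ring
  have hy1 : y 1 = q - m := by rw [hysucc, hy0, mul_one]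
  have hyanti : Antitone y := by
    refine antitone_nat_of_succ_le fun k => ?_
    simp only [hy]
    have : q ^ k ≤ q ^ (k + 1) := pow_le_pow_right₀ hq.le (Nat.le_succ k)
    have h2 : 0 < m + 1 - q := by linarith
    have h3 : 0 < q - 1 := by linarith
    gcongr
  have hyne : ∀ k s : ℕ, 1 ≤ k → s ≤ m → q * y k ≠ s := by
    intro k s hk hs h
    refine hbrauer k s hk hs ?_
    simp only [hy] at h
    rw [← mul_div_assoc, div_eq_iff hq1] at h
    linear_combination h
  have key : ∀ k, y k ∈ Y ∧ 1 / 2 < y k := by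
    intro k
    induction k with
    | zero => rw [hy0]; exact ⟨hYone, by norm_num⟩
    | succ k ih =>
      obtain ⟨hk, hhalf⟩ := ih
      suffices h : m + 1 / 2 < q * y k by
        rw [hysucc]
        exact ⟨by simpa using hYstep _ hk m (by simp), by linarith⟩
      by_contra! hle
      -- the digit nearest to `q * y k`
      set s := min ⌊q * y k + 1 / 2⌋₊ m with hs
      have hsm : s ≤ m := min_le_right _ _
      have hqy : 1 / 2 < q * y k := by nlinarith
      have f1 := Nat.floor_le (by linarith : 0 ≤ q * y k + 1 / 2)
      have f2 := Nat.lt_floor_add_one (q * y k + 1 / 2)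
      have hse : |q * y k - s| ≤ 1 / 2 := by
        rw [abs_le]
        rcases le_total ⌊q * y k + 1 / 2⌋₊ m with h | h
        · rw [hs, min_eq_left h]
          constructor <;> linarith
        · rw [hs, min_eq_right h]
          have : (m : ℝ) ≤ ⌊q * y k + 1 / 2⌋₊ := by exact_mod_cast h
          constructor <;> linarith
      obtain ⟨he1, he2⟩ := abs_le.mp hse
      have hs1 : 1 ≤ s := by
        refine le_min (Nat.le_floor ?_) hm1
        push_cast
        linarith
      have hsR : (s : ℝ) ≤ m := by exact_mod_cast hsm
      have heY : q * y k - s ∈ Y := by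
        simpa using hYstep _ hk s (by rw [Nat.abs_cast]; exact_mod_cast hsm)
      have hηY : 1 ≤ k → m + 1 - q ∈ Y → False := by
        intro hk1 hmem
        have h1 := hη hmem
        have h2 := hyanti hk1
        rw [hy1] at h2
        linarith
      rcases lt_trichotomy (q * y k - s) 0 with he | he | he
      · obtain ⟨r, hrm, hr⟩ := hsmall _ (hYneg _ heY) (by linarith) (by linarith)
        have hr1 : 1 ≤ r := by
          have : (0 : ℝ) < r := by rw [← hr]; exact mul_pos hq0 (by linarith)
          exact_mod_cast this
        refine hηY ?_ ?_
        · rw [Nat.one_le_iff_ne_zero]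
          rintro rfl
          rw [hy0] at he
          linarith
        · -- `q * (q * y k - (s - 1)) - (m + 1 - r) = -(m + 1 - q)`
          have h1 := hYstep _ hk (s - 1) (by rw [abs_le]; constructor <;> omega)
          have h2 := hYneg _ (hYstep _ h1 (m + 1 - r) (by rw [abs_le]; constructor <;> omega))
          convert h2 using 1
          push_cast
          linarith
      · rcases Nat.eq_zero_or_pos k with rfl | hk1
        · rw [hy0] at he
          linarith
        · exact hyne k s hk1 hsm (by linarith)
      · obtain ⟨r, hrm, hr⟩ := hsmall _ heY he he2
        have hr1 : 1 ≤ r := by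
          have : (0 : ℝ) < r := by rw [← hr]; exact mul_pos hq0 he
          exact_mod_cast this
        rcases hsm.lt_or_eq with hlt | heq
        · have hlt' : (s : ℝ) + 1 ≤ m := by exact_mod_cast hlt
          refine hηY ?_ ?_
          · rw [Nat.one_le_iff_ne_zero]
            rintro rfl
            rw [hy0] at he2
            linarith
          · -- `q * (q * y k - (s + 1)) + (m + 1 - r) = m + 1 - q`
            have h1 := hYstep _ hk (s + 1) (by rw [abs_le]; constructor <;> omega)
            have h2 := hYstep _ h1 (-(m + 1 - r)) (by rw [abs_le]; constructor <;> omega)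
            convert h2 using 1
            push_cast
            linarith
        · refine hyne (k + 1) r (by omega) hrm ?_
          rw [hysucc, ← hr, heq]
  obtain ⟨k, hk⟩ := pow_unbounded_of_one_lt (m / (m + 1 - q)) hq
  rw [div_lt_iff₀ (by linarith)] at hk
  have h1 := (key k).2
  simp only [hy] at h1
  rw [lt_div_iff₀ (by linarith)] at h1
  linarith

theorem aeval_eq_zero_of_isConjRoot {x y : ℂ} (h : IsConjRoot ℚ x y) {P : ℤ[X]}
    (hP : aeval x P = 0) : aeval y P = 0 := by
  have h1 : aeval x (P.map (Int.castRingHom ℚ)) = 0 := by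
    rwa [← algebraMap_int_eq, aeval_map_algebraMap]
  have h2 := minpoly.dvd ℚ x h1
  rw [h] at h2
  have h3 := aeval_eq_zero_of_dvd_aeval_eq_zero h2 (minpoly.aeval ℚ y)
  rwa [← algebraMap_int_eq, aeval_map_algebraMap] at h3

theorem not_separatedValues_of_not_isPisot {m : ℕ} {q : ℝ} (hq : 1 < q) (hP : ¬ IsPisot q)
    (hm : q - 1 < m) : ¬ SeparatedValues (2 * m) q := by
  intro hsep
  have hint := hsep.isIntegral hq (by linarith)
  have hex : ∃ z : ℂ, IsConjRoot ℚ (q : ℂ) z ∧ z ≠ q ∧ 1 ≤ ‖z‖ := by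
    by_contra! h
    exact hP ⟨hq, hint, fun z h1 h2 => h z h1 h2⟩
  obtain ⟨z, hconj, hzq, hz1⟩ := hex
  have hz : ∀ P : ℤ[X], aeval q P = 0 → aeval z P = 0 := fun P h =>
    aeval_eq_zero_of_isConjRoot hconj (by
      rw [show (q : ℂ) = algebraMap ℝ ℂ q from rfl, aeval_algebraMap_apply, h, map_zero])
  have hroot : ∀ g : ℕ, 0 < g → z ^ g ≠ 1 := by
    intro g hg h
    have h1 := aeval_eq_zero_of_isConjRoot (P := X ^ g - 1) hconj.symm (by simp [h])
    have h2 : q ^ g = 1 := by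
      have : (q : ℂ) ^ g = 1 := by simpa [sub_eq_zero] using h1
      exact_mod_cast this
    exact (one_lt_pow₀ hq hg.ne').ne' h2
  have hfl := Nat.floor_le (by linarith : 0 ≤ q)
  have hfl2 := Nat.lt_floor_add_one q
  have hflm : ⌊q⌋₊ ≤ m := by
    have : ((⌊q⌋₊ : ℕ) : ℝ) < ((m + 1 : ℕ) : ℝ) := by push_cast; linarith
    exact Nat.lt_succ_iff.mp (by exact_mod_cast this)
  -- an integer `q` has no conjugate other than itself, so `⌊q⌋ < q`
  refine (hsep.mono (by omega : 2 * ⌊q⌋₊ ≤ 2 * m)).false_of_conjugate hq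
    (lt_of_le_of_ne hfl fun h => hzq ?_) hfl2 hz hz1 hroot hzq
  have h1 := hz (X - C (⌊q⌋₊ : ℤ)) (by simp [h])
  rw [← h]
  simpa [sub_eq_zero] using h1

end

/-! ### Vanishing of the extreme gaps -/

theorem theorem1p3 (q : ℝ) (hq : 1 < q) (hP : ¬ IsPisot q) (m : ℕ) (hm : q - 1 < (m : ℝ)) :
    liminfGap (2 * m) q = 0 ∧ limsupGap (3 * m) q = 0 := by
  refine gaps_eq_zero_of_small_differences hq hm fun ε hε => ?_
  have hsep := not_separatedValues_of_not_isPisot hq hP hm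
  unfold SeparatedValues at hsep
  push Not at hsep
  obtain ⟨P, hPm, hP0, hPε⟩ := hsep ε hε
  obtain ⟨x, hx, y, hy, hxy⟩ := hPm.exists_sub_eq q
  rw [← hxy] at hP0 hPε
  rw [abs_lt] at hPε
  rcases lt_or_gt_of_ne hP0 with h | h
  · exact ⟨y, hy, x, hx, by linarith, by linarith⟩
  · exact ⟨x, hx, y, hy, by linarith, by linarith⟩
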